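/- **Conventions.** For a sequence $M=(M_p)_{p\ge0}$ of positive reals with $M_0=1$ put $m_p=M_{p+1}/M_p$ $(p\ge 0)$, $\widehat M=(p!\,M_p)_{p\ge0}$, with quotients $\widehat m_p=(p+1)m_p$. $M$ is a *weight sequence* if $M_p^2\le M_{p-1}M_{p+1}$ for $p\ge1$ and $M_p^{1/p}\to\infty$. Moreover: * (mg): there is $A>0$ with $M_{p+q}\le A^{p+q}M_pM_q$ for all $p,q\ge0$; * (snq): there is $B>0$ with $\sum_{q\ge p}\frac{M_q}{(q+1)M_{q+1}}\le B\frac{M_p}{M_{p+1}}$ for all $p\ge0$; * $(\gamma_1)$ for $m$: there is $C>0$ with $\sum_{k\ge p}\frac1{m_k}\le \frac{C(p+1)}{m_p}$ for all $p\ge0$; * $\gamma(M)$ is the supremum in $[-\infty,\infty]$ of the $\gamma\in\mathbb R$ for which there are a real sequence $(\ell_p)_{p\ge0}$ and $a\ge1$ such that $a^{-1}m_p\le\ell_p\le a\,m_p$ for all $p$ and $((p+1)^{-\gamma}\ell_p)_p$ is nondecreasing; $\omega(M)=\liminf_{p\to\infty}\frac{\log m_p}{\log p}$. For a measurable $f$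 that is positive near $\infty$, the orders are $\mu(f)=\liminf_{x\to\infty}\frac{\log f(x)}{\log x}$ and $\rho(f)=\limsup_{x\to\infty}\frac{\log f(x)}{\log x}$, and the Matuszewska indices are $$\alpha(f)=\inf\Big\{\alpha\in\mathbb R:\exists C>0\ \forall\Lambda>1:\ \limsup_{x\to\infty}\sup_{\lambda\in[1,\Lambda]}\tfrac{f(\lambda x)}{\lambda^{\alpha}f(x)}\le C\Big\},$$ $$\beta(f)=\sup\Big\{\beta\in\mathbb R:\exists D>0\ \forall\Lambda>1:\ \liminf_{x\to\infty}\inf_{\lambda\in[1,\Lambda]}\tfrac{f(\lambda x)}{\lambda^{\beta}f(x)}\ge D\Big\}.$$ $\rho(M)$ and $\alpha(M)$ denote $\rho(f)$ and $\alpha(f)$ for the step function $f(x)=m_{\lfloor x\rfloor-1}$, $x\ge1$. For a nondecreasing $\sigma:[0,\infty)\to[0,\infty)$ tending to $\infty$, $\gamma(\sigma)\in[0,\infty]$ is the supremum of the $\gamma>0$ for which there is $K>1$ with $\limsup_{t\to\infty}\sigma(K^\gamma t)/\sigma(t)<K$ ($\gamma(\sigma)=0$ if there is none), and $\sigma$ has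 $(\omega_{\rm snq})$ if there is $C\ge1$ with $\int_1^\infty\sigma(yt)t^{-2}\,dt\le C\sigma(y)+C$ for all $y>0$. The *associated function* of $M$ is $\omega_M(t)=\sup_{p\ge0}\log(t^p/M_p)$ for $t>0$, $\omega_M(0)=0$. **Statement.** Let $a_1=1$, $b_j=2a_j$, $a_{j+1}=b_j^2$ and $c_j=2^{2^{j+1}}$ for $j\ge1$. Let $\delta_k=c_j$ if $a_j+1\le k\le b_j$ for some $j\ge1$, and $\delta_k=0$ for all other $k\ge1$. Put $m_p=\exp\big(\sum_{k=1}^p\delta_k\big)$ for $p\ge0$ (so $m_0=1$) and $M_p=m_0m_1\cdots m_{p-1}$, $M_0=1$. Then $M$ and $\widehat M$ are weight sequences, $m$ is the sequence of quotients of $M$, and: 1. $\gamma(M)=0$ and $\gamma(\widehat M)=1$; $M$ does not satisfy (snq), and $\widehat m$ does not satisfy $(\gamma_1)$. 2. $\omega(M)=\rho(M)=\alpha(M)=\infty$ and $\omega(\widehat M)=\rho(\widehat M)=\alpha(\widehat M)=\infty$; neither $M$ nor $\widehat M$ satisfies (mg). 3. $\beta(\omega_M)=\mu(\omega_M)=\rho(\omega_M)=\alpha(\omega_M)=0$,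 $\gamma(\omega_M)=\infty$, and $\omega_M$ has $(\omega_{\rm snq})$. 4. $\beta(\omega_{\widehat M})=\mu(\omega_{\widehat M})=\rho(\omega_{\widehat M})=\alpha(\omega_{\widehat M})=0$, $\gamma(\omega_{\widehat M})=\infty$, and $\omega_{\widehat M}$ has $(\omega_{\rm snq})$. In particular $\gamma(M)<\gamma(\omega_M)$ and $\gamma(\widehat M)<\gamma(\omega_{\widehat M})$. -/

import Mathlib

open Filter Set MeasureTheory

namespace WeightIndices

/-! ### Weight sequences and their growth conditions -/

/-- A weight sequence: positive reals with `M 0 = 1`, logarithmically convex, and with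
`(M p)^(1/p)` tending to infinity. -/
structure IsWeightSequence (M : ℕ → ℝ) : Prop where
  pos : ∀ p, 0 < M p
  zero : M 0 = 1
  logConvex : ∀ p : ℕ, 1 ≤ p → M p ^ 2 ≤ M (p - 1) * M (p + 1)
  root_tendsto : Tendsto (fun p : ℕ => M p ^ ((1 : ℝ) / (p : ℝ))) atTop atTop

/-- The sequence of quotients `m_p = M_{p+1} / M_p`, indexed by `p ≥ 0`. -/
noncomputable def quot (M : ℕ → ℝ) (p : ℕ) : ℝ := M (p + 1) / M p

/-- The sequence `(p! M_p)_p`. -/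
noncomputable def hat (M : ℕ → ℝ) (p : ℕ) : ℝ := (Nat.factorial p : ℝ) * M p

/-- Moderate growth (mg). -/
def ModerateGrowth (M : ℕ → ℝ) : Prop :=
  ∃ A : ℝ, 0 < A ∧ ∀ p q : ℕ, M (p + q) ≤ A ^ (p + q) * M p * M q

/-- The strong nonquasianalyticity condition (snq); the series is required to converge. -/
def StrongNonquasianalytic (M : ℕ → ℝ) : Prop :=
  ∃ B : ℝ, 0 < B ∧ Summable (fun q : ℕ => M q / (((q : ℝ) + 1) * M (q + 1))) ∧
    ∀ p : ℕ, (∑' i : ℕ, M (p + i) / ((((p + i : ℕ) : ℝ) + 1) * M (p + i + 1)))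
      ≤ B * (M p / M (p + 1))

/-- Condition (γ₁) for a sequence of positive numbers `m = (m_p)_{p ≥ 0}`; the series is
required to converge. -/
def GammaOne (m : ℕ → ℝ) : Prop :=
  ∃ C : ℝ, 0 < C ∧ Summable (fun k : ℕ => 1 / m k) ∧
    ∀ p : ℕ, (∑' i : ℕ, 1 / m (p + i)) ≤ C * ((p : ℝ) + 1) / m p

/-- Property `(P_γ)` of a sequence `M`. -/
def SeqP (M : ℕ → ℝ) (g : ℝ) : Prop :=
  ∃ l : ℕ → ℝ,
    (∃ a : ℝ, 1 ≤ a ∧ ∀ p, a⁻¹ * quot M p ≤ l p ∧ l p ≤ a * quot M p) ∧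
    Monotone (fun p : ℕ => ((p : ℝ) + 1) ^ (-g) * l p)

/-- The growth index `γ(M)`, an extended real (`sup ∅ = -∞`, `sup ℝ = ∞`). -/
noncomputable def gammaSeq (M : ℕ → ℝ) : EReal :=
  sSup ((fun g : ℝ => (g : EReal)) '' {g : ℝ | SeqP M g})

/-- The growth index `ω(M) = liminf log m_p / log p`. -/
noncomputable def omegaSeq (M : ℕ → ℝ) : EReal :=
  liminf (fun p : ℕ => ((Real.log (quot M p) / Real.log (p : ℝ) : ℝ) : EReal)) atTop

/-! ### Matuszewska indices and orders

The functions are meant to be positive near infinity; only their values near infinity matter. -/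

/-- The upper Matuszewska index `α(f)`. -/
noncomputable def upperMatuszewska (f : ℝ → ℝ) : EReal :=
  sInf ((fun a : ℝ => (a : EReal)) '' {a : ℝ | ∃ C : ℝ, 0 < C ∧ ∀ L : ℝ, 1 < L →
    limsup (fun x : ℝ => ⨆ l ∈ Set.Icc (1 : ℝ) L, ((f (l * x) / (l ^ a * f x) : ℝ) : EReal)) atTop
      ≤ (C : EReal)})

/-- The lower Matuszewska index `β(f)`. -/
noncomputable def lowerMatuszewska (f : ℝ → ℝ) : EReal :=
  sSup ((fun b : ℝ => (b : EReal)) '' {b : ℝ | ∃ D : ℝ, 0 < D ∧ ∀ L : ℝ, 1 < L →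
    (D : EReal) ≤
      liminf (fun x : ℝ => ⨅ l ∈ Set.Icc (1 : ℝ) L, ((f (l * x) / (l ^ b * f x) : ℝ) : EReal))
        atTop})

/-- The upper order `ρ(f)`. -/
noncomputable def upperOrder (f : ℝ → ℝ) : EReal :=
  limsup (fun x : ℝ => ((Real.log (f x) / Real.log x : ℝ) : EReal)) atTop

/-- The lower order `μ(f)`. -/
noncomputable def lowerOrder (f : ℝ → ℝ) : EReal :=
  liminf (fun x : ℝ => ((Real.log (f x) / Real.log x : ℝ) : EReal)) atTop

/-- The step function `x ↦ a_{⌊x⌋}` (for `x ≥ 1`) of the sequence `a = (m_{p-1})_{p ≥ 1}` of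
quotients of `M`. The indices of the sequence of quotients are those of this function. -/
noncomputable def quotStep (M : ℕ → ℝ) (x : ℝ) : ℝ := quot M (⌊x⌋₊ - 1)

/-- Property `(P_{σ,γ})` of a nondecreasing function `σ`. -/
def FunP (σ : ℝ → ℝ) (g : ℝ) : Prop :=
  ∃ K : ℝ, 1 < K ∧
    limsup (fun t : ℝ => ((σ (K ^ g * t) / σ t : ℝ) : EReal)) atTop < (K : EReal)

/-- The growth index `γ(σ) ∈ [0, ∞]`; it is `0` when no `(P_{σ,γ})`, `γ > 0`, holds. -/
noncomputable def gammaFun (σ : ℝ → ℝ) : EReal :=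
  max 0 (sSup ((fun g : ℝ => (g : EReal)) '' {g : ℝ | 0 < g ∧ FunP σ g}))

/-! ### The associated function -/

/-- The associated function `ω_M`, with `ω_M(0) = 0`. It is only used for `t ≥ 0`; for a weight
sequence the supremum is finite, see `IsWeightSequence.bddAbove_log`. -/
noncomputable def assoc (M : ℕ → ℝ) (t : ℝ) : ℝ :=
  if t = 0 then 0 else ⨆ p : ℕ, Real.log (t ^ p / M p)

theorem IsWeightSequence.bddAbove_log {M : ℕ → ℝ} (hM : IsWeightSequence M) {t : ℝ}
    (ht : 0 < t) : BddAbove (Set.range fun p : ℕ => Real.log (t ^ p / M p)) := by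
  have h1 : ∀ᶠ p : ℕ in atTop, Real.log (t ^ p / M p) ≤ 0 := by
    filter_upwards [hM.root_tendsto.eventually_ge_atTop t, eventually_ge_atTop 1] with p hp hp1
    have hp0 : (p : ℝ) ≠ 0 := by positivity
    have h2 : t ^ p ≤ M p := by
      calc t ^ p ≤ (M p ^ ((1 : ℝ) / (p : ℝ))) ^ p := pow_le_pow_left₀ ht.le hp p
        _ = M p := by
          rw [← Real.rpow_natCast, ← Real.rpow_mul (hM.pos p).le, one_div_mul_cancel hp0,
            Real.rpow_one]
    exact Real.log_nonpos (div_nonneg (pow_nonneg ht.le p) (hM.pos p).le)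
      ((div_le_one (hM.pos p)).2 h2)
  exact (isBoundedUnder_of_eventually_le h1).bddAbove_range

/-- Condition (ω_snq) for a function on `[0, ∞)`; the integrals are required to converge. -/
def OmegaSnq (σ : ℝ → ℝ) : Prop :=
  ∃ C : ℝ, 1 ≤ C ∧ ∀ y : ℝ, 0 < y →
    IntegrableOn (fun t : ℝ => σ (y * t) / t ^ 2) (Set.Ioi 1) ∧
    (∫ t in Set.Ioi (1 : ℝ), σ (y * t) / t ^ 2) ≤ C * σ y + C

/-! ### The explicit sequence -/

/-- `a_1 = 1`, `a_{j+1} = (2 a_j)^2`. The index `0` is not used. -/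
def seqA : ℕ → ℕ
  | 0 => 0
  | 1 => 1
  | (j + 2) => (2 * seqA (j + 1)) ^ 2

/-- `b_j = 2 a_j`, for `j ≥ 1`. -/
def seqB (j : ℕ) : ℕ := 2 * seqA j

/-- `c_j = 2^(2^(j+1))`. -/
def seqC (j : ℕ) : ℝ := 2 ^ (2 ^ (j + 1))

open Classical in
/-- `δ_k = c_j` if `a_j + 1 ≤ k ≤ b_j` for some (necessarily unique) `j ≥ 1`, and `δ_k = 0`
otherwise, see `delta_eq_seqC` and `delta_eq_zero`. -/
noncomputable def delta (k : ℕ) : ℝ :=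
  if h : ∃ j : ℕ, 1 ≤ j ∧ seqA j + 1 ≤ k ∧ k ≤ seqB j then seqC h.choose else 0

/-- `m_p = exp (δ_1 + ... + δ_p)`, in particular `m_0 = 1`. -/
noncomputable def exQuot (p : ℕ) : ℝ := Real.exp (∑ k ∈ Finset.Icc 1 p, delta k)

/-- `M_p = m_0 m_1 ... m_{p-1}`. -/
noncomputable def exSeq (p : ℕ) : ℝ := ∏ q ∈ Finset.range p, exQuot q

theorem seqA_strictMono : StrictMono seqA := by
  refine strictMono_nat_of_lt_succ fun j => ?_
  match j with
  | 0 => simp [seqA]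
  | (j + 1) =>
    have h : ∀ i, 1 ≤ seqA (i + 1) := by
      intro i
      induction i with
      | zero => simp [seqA]
      | succ i ih => simp only [seqA]; nlinarith
    have := h j
    simp only [seqA]
    nlinarith

theorem seqB_lt_seqA_succ {j : ℕ} (hj : 1 ≤ j) : seqB j < seqA (j + 1) := by
  obtain ⟨i, rfl⟩ : ∃ i, j = i + 1 := ⟨j - 1, by omega⟩
  have h : seqA 0 < seqA (i + 1) := seqA_strictMono (by omega)
  simp only [seqB, seqA] at *
  nlinarith

theorem delta_eq_seqC {j k : ℕ} (hj : 1 ≤ j) (h1 : seqA j + 1 ≤ k) (h2 : k ≤ seqB j) :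
    delta k = seqC j := by
  have hex : ∃ j : ℕ, 1 ≤ j ∧ seqA j + 1 ≤ k ∧ k ≤ seqB j := ⟨j, hj, h1, h2⟩
  have hs := hex.choose_spec
  rw [delta, dif_pos hex]
  congr 1
  rcases lt_trichotomy hex.choose j with h | h | h
  · have := seqB_lt_seqA_succ hs.1
    have := seqA_strictMono.monotone (show hex.choose + 1 ≤ j from h)
    omega
  · exact h
  · have := seqB_lt_seqA_succ hj
    have := seqA_strictMono.monotone (show j + 1 ≤ hex.choose from h)
    omega

theorem delta_one : delta 1 = 0 := by
  rw [delta, dif_neg]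
  rintro ⟨j, hj, h1, -⟩
  have h : seqA 0 < seqA j := seqA_strictMono (by omega)
  omega

theorem delta_eq_zero {j k : ℕ} (h1 : seqB j + 1 ≤ k) (h2 : k ≤ seqA (j + 1)) :
    delta k = 0 := by
  rw [delta, dif_neg]
  rintro ⟨i, hi, h3, h4⟩
  rcases le_or_gt i j with h | h
  · have := seqA_strictMono.monotone h
    simp only [seqB] at *
    omega
  · have := seqA_strictMono.monotone (show j + 1 ≤ i from h)
    omega

end WeightIndices

open WeightIndices

open scoped Topology

namespace WeightIndices

/-! ### The exponents of the explicit sequence -/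

/-! The quotients `m_p` combine long plateaus with enormous jumps, and the indices of `M` and of its
associated function see different features.

On `[b_j, b_j ^ 2]` the sequence `m` is constant. There `l` can vary only by a factor `a ^ 2`, while
`(p + 1) ^ g` gains about `b_j ^ g`, so no `g > 0` is admissible. The sum of `1 / (q + 1)` over the
plateau is about `log b_j`, which is unbounded, so (snq) fails for `M`. Condition (γ₁) for the
quotients of `hat M` involves the same series, and passing to `hat M` raises `γ` by exactly 1.

Between `a_j` and `2 * a_j` the logarithm of `m` increases by `16 * a_j ^ 3`. Doubling the argument
thus multiplies `m` by an unbounded factor, and `log m_p / p → ∞` even at the right end of the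
plateaus. This makes the upper indices infinite and excludes (mg).

For the associated function only `log m_p / p → ∞` matters. The supremum defining `ω_M (l * x)` is
attained at an index `p ≤ n` once `l * x ≤ m_n`, so `ω_M (l * x) ≤ ω_M x + n * log l`
(`assoc_mul_le`). One may take `n = o(log x)` for fixed `l`, while `ω_M x ≥ log x - log M_1`. Hence
`ω_M` is slowly varying, which settles its Matuszewska indices and `γ`. A cruder choice of `n` gives
a bound uniform in `x` and `l`, from which the orders and (ω_snq) follow. As `hat M` has even larger
quotients, the same argument covers it. -/

/-- The logarithm `δ_1 + ... + δ_p` of `m_p`. -/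
noncomputable def deltaSum (p : ℕ) : ℝ := ∑ k ∈ Finset.Icc 1 p, delta k

theorem exQuot_eq (p : ℕ) : exQuot p = Real.exp (deltaSum p) := rfl

theorem log_exQuot (p : ℕ) : Real.log (exQuot p) = deltaSum p := Real.log_exp _

theorem exQuot_pos (p : ℕ) : 0 < exQuot p := Real.exp_pos _

theorem seqC_pos (j : ℕ) : 0 < seqC j := by unfold seqC; positivity

theorem delta_nonneg (k : ℕ) : 0 ≤ delta k := by
  unfold delta
  split_ifs
  · exact (seqC_pos _).le
  · exact le_rfl

theorem deltaSum_zero : deltaSum 0 = 0 := by simp [deltaSum]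

theorem deltaSum_succ (p : ℕ) : deltaSum (p + 1) = deltaSum p + delta (p + 1) :=
  Finset.sum_Icc_succ_top (by omega) _

theorem deltaSum_mono : Monotone deltaSum :=
  monotone_nat_of_le_succ fun p => by
    rw [deltaSum_succ]
    exact le_add_of_nonneg_right (delta_nonneg _)

theorem deltaSum_nonneg (p : ℕ) : 0 ≤ deltaSum p :=
  deltaSum_zero ▸ deltaSum_mono (Nat.zero_le p)

theorem exQuot_mono : Monotone exQuot := fun _ _ h => Real.exp_le_exp.2 (deltaSum_mono h)

theorem seqA_succ {j : ℕ} (hj : 1 ≤ j) : seqA (j + 1) = seqB j ^ 2 := by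
  obtain ⟨i, rfl⟩ : ∃ i, j = i + 1 := ⟨j - 1, by omega⟩
  rfl

/-- The recursion is pure squaring in the variable `4 * a`, since `4 * (2 * a) ^ 2 = (4 * a) ^ 2`.
It lets `c_j` be written as `(4 * a_j) ^ 2`. -/
theorem four_mul_seqA_succ (j : ℕ) : 4 * seqA (j + 1) = 2 ^ 2 ^ (j + 1) := by
  induction j with
  | zero => simp [seqA]
  | succ j ih =>
    rw [pow_succ 2 (j + 1), pow_mul, ← ih, seqA_succ (by omega), seqB]
    ring

theorem seqC_eq {j : ℕ} (hj : 1 ≤ j) : seqC j = 16 * (seqA j : ℝ) ^ 2 := by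
  obtain ⟨i, rfl⟩ : ∃ i, j = i + 1 := ⟨j - 1, by omega⟩
  have h := four_mul_seqA_succ i
  have h' : (4 * seqA (i + 1) : ℝ) = 2 ^ 2 ^ (i + 1) := by exact_mod_cast h
  rw [seqC, pow_succ 2 (i + 1), pow_mul, ← h']
  ring

theorem deltaSum_seqB {j : ℕ} (hj : 1 ≤ j) :
    deltaSum (seqB j) = deltaSum (seqA j) + 16 * (seqA j : ℝ) ^ 3 := by
  have h : ∀ i ≤ seqA j, deltaSum (seqA j + i) = deltaSum (seqA j) + i * seqC j := by
    intro i
    induction i with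
    | zero => simp
    | succ i ih =>
      intro hi
      rw [← add_assoc, deltaSum_succ, ih (by omega),
        delta_eq_seqC hj (by omega) (by unfold seqB; omega)]
      push_cast
      ring
  rw [seqB, two_mul, h _ le_rfl, seqC_eq hj]
  ring

theorem deltaSum_eq_of_le_seqA_succ {j q : ℕ} (h1 : seqB j ≤ q) (h2 : q ≤ seqA (j + 1)) :
    deltaSum q = deltaSum (seqB j) := by
  induction q, h1 using Nat.le_induction with
  | base => rfl
  | succ q hq ih =>
    rw [deltaSum_succ, ih (by omega), delta_eq_zero (by omega) h2, add_zero]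

theorem exists_exQuot_plateau (n : ℕ) :
    ∃ b ≥ n, ∀ q, b ≤ q → q ≤ b ^ 2 → exQuot q = exQuot b := by
  have h := seqA_strictMono.le_apply (x := n + 1)
  refine ⟨seqB (n + 1), by unfold seqB; omega, fun q h1 h2 => ?_⟩
  rw [exQuot_eq, exQuot_eq, deltaSum_eq_of_le_seqA_succ h1]
  rwa [seqA_succ (by omega)]

theorem exists_deltaSum_jump (n : ℕ) :
    ∃ a ≥ n, deltaSum (2 * a) = deltaSum a + 16 * (a : ℝ) ^ 3 := by
  have h := seqA_strictMono.le_apply (x := n + 1)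
  exact ⟨seqA (n + 1), by omega, deltaSum_seqB (by omega)⟩

theorem exists_seqB_le_lt {q : ℕ} (hq : 2 ≤ q) : ∃ j ≥ 1, seqB j ≤ q ∧ q < seqB (j + 1) := by
  induction q, hq using Nat.le_induction with
  | base => exact ⟨1, le_rfl, by simp [seqB, seqA], by simp [seqB, seqA]⟩
  | succ q hq ih =>
    obtain ⟨j, hj, h1, h2⟩ := ih
    rcases lt_or_ge (q + 1) (seqB (j + 1)) with h | h
    · exact ⟨j, hj, by omega, h⟩
    · have := seqA_strictMono (show j + 1 < j + 1 + 1 by omega)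
      exact ⟨j + 1, by omega, h, by unfold seqB at *; omega⟩

/-- With `a = a_j` and `b_j ≤ q < b_{j+1} = 8 * a ^ 2`, the jump ending at `b_j` already contributes
`16 * a ^ 3 = 2 * a * (8 * a ^ 2) ≥ 2 * a * q`. As `a` is at least of order `√q`, the growth is
superlinear. -/
theorem exists_mul_le_deltaSum {q : ℕ} (hq : 2 ≤ q) :
    ∃ a : ℕ, q ≤ 8 * a ^ 2 ∧ 2 * (a : ℝ) * q ≤ deltaSum q := by
  obtain ⟨j, hj, h1, h2⟩ := exists_seqB_le_lt hq
  have h3 : q ≤ 8 * seqA j ^ 2 := by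
    rw [seqB, seqA_succ hj, seqB] at h2
    nlinarith
  refine ⟨seqA j, h3, ?_⟩
  have h4 := deltaSum_mono h1
  rw [deltaSum_seqB hj] at h4
  have h5 := deltaSum_nonneg (seqA j)
  have h6 : (q : ℝ) ≤ 8 * (seqA j : ℝ) ^ 2 := by exact_mod_cast h3
  have h7 : 2 * (seqA j : ℝ) * q ≤ 2 * (seqA j : ℝ) * (8 * (seqA j : ℝ) ^ 2) := by gcongr
  nlinarith

theorem tendsto_deltaSum_div : Tendsto (fun p : ℕ => deltaSum p / p) atTop atTop := by
  refine tendsto_atTop.2 fun K => ?_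
  obtain ⟨N, hN⟩ := exists_nat_ge K
  filter_upwards [eventually_ge_atTop (8 * N ^ 2 + 2)] with q hq
  obtain ⟨a, h1, h2⟩ := exists_mul_le_deltaSum (show 2 ≤ q by omega)
  have h3 : N ≤ a := by
    by_contra! h
    nlinarith
  have hq0 : (0 : ℝ) < q := by
    have : 0 < q := by omega
    exact_mod_cast this
  rw [le_div_iff₀ hq0]
  have h4 : (N : ℝ) ≤ a := by exact_mod_cast h3
  have h5 : (0 : ℝ) ≤ N := Nat.cast_nonneg N
  nlinarith

theorem sub_one_le_deltaSum (p : ℕ) : (p : ℝ) - 1 ≤ deltaSum p := by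
  rcases lt_or_ge p 2 with h | h
  · have h' : (p : ℝ) ≤ 1 := by exact_mod_cast (by omega : p ≤ 1)
    linarith [deltaSum_nonneg p]
  · obtain ⟨a, h1, h2⟩ := exists_mul_le_deltaSum h
    have ha : 1 ≤ a := by
      by_contra! h0
      have : a = 0 := by omega
      subst this
      omega
    have ha' : (1 : ℝ) ≤ a := by exact_mod_cast ha
    have hp : (0 : ℝ) ≤ p := Nat.cast_nonneg p
    nlinarith

/-! ### The sequences `M` and `(p! M_p)_p` as weight sequences -/

theorem exSeq_pos (p : ℕ) : 0 < exSeq p := Finset.prod_pos fun q _ => exQuot_pos q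

theorem exSeq_succ (p : ℕ) : exSeq (p + 1) = exSeq p * exQuot p := Finset.prod_range_succ _ _

theorem quot_exSeq (p : ℕ) : quot exSeq p = exQuot p := by
  rw [quot, exSeq_succ, mul_div_cancel_left₀ _ (exSeq_pos p).ne']

/-- The exponent is the sum of the lower bounds `q - 1` for `log m_q` over `q < p`; its `p`-th part
tends to infinity. -/
theorem exp_le_exSeq (p : ℕ) : Real.exp (p * ((p - 3) / 2)) ≤ exSeq p := by
  induction p with
  | zero => simp [exSeq]
  | succ p ih =>
    rw [exSeq_succ]
    calc Real.exp ((p + 1 : ℕ) * (((p + 1 : ℕ) - 3) / 2))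
        = Real.exp (p * ((p - 3) / 2)) * Real.exp (p - 1) := by
          rw [← Real.exp_add]
          push_cast
          ring_nf
      _ ≤ exSeq p * exQuot p := by
          gcongr
          · exact (exSeq_pos p).le
          · exact Real.exp_le_exp.2 (sub_one_le_deltaSum p)

theorem tendsto_root_of_exSeq_le {N : ℕ → ℝ} (h : ∀ p, exSeq p ≤ N p) :
    Tendsto (fun p : ℕ => N p ^ ((1 : ℝ) / (p : ℝ))) atTop atTop := by
  have h1 : Tendsto (fun p : ℕ => Real.exp (((p : ℝ) - 3) / 2)) atTop atTop :=
    Real.tendsto_exp_atTop.comp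
      ((tendsto_atTop_add_const_right _ (-3) tendsto_natCast_atTop_atTop).atTop_div_const
        two_pos)
  refine tendsto_atTop_mono' _ ?_ h1
  filter_upwards [eventually_ge_atTop 1] with p hp
  have hp0 : (p : ℝ) ≠ 0 := by positivity
  calc Real.exp (((p : ℝ) - 3) / 2)
      = Real.exp (p * ((p - 3) / 2)) ^ ((1 : ℝ) / (p : ℝ)) := by
        rw [← Real.exp_mul]
        congr 1
        field_simp
    _ ≤ N p ^ ((1 : ℝ) / (p : ℝ)) :=
        Real.rpow_le_rpow (Real.exp_pos _).le ((exp_le_exSeq p).trans (h p)) (by positivity)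

theorem isWeightSequence_exSeq : IsWeightSequence exSeq where
  pos := exSeq_pos
  zero := by simp [exSeq]
  logConvex := by
    intro p hp
    obtain ⟨i, rfl⟩ : ∃ i, p = i + 1 := ⟨p - 1, by omega⟩
    rw [Nat.add_sub_cancel, exSeq_succ (i + 1), exSeq_succ i]
    have h1 := exSeq_pos i
    have h2 := exQuot_pos i
    have h3 := exQuot_mono (Nat.le_succ i)
    calc (exSeq i * exQuot i) ^ 2 = exSeq i * (exSeq i * exQuot i * exQuot i) := by ring
      _ ≤ exSeq i * (exSeq i * exQuot i * exQuot (i + 1)) := by gcongr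
  root_tendsto := tendsto_root_of_exSeq_le fun _ => le_rfl

theorem le_hat {M : ℕ → ℝ} (hM : ∀ p, 0 < M p) (p : ℕ) : M p ≤ hat M p :=
  le_mul_of_one_le_left (hM p).le (by exact_mod_cast Nat.one_le_iff_ne_zero.2 p.factorial_ne_zero)

theorem isWeightSequence_hat {M : ℕ → ℝ} (hM : IsWeightSequence M)
    (h : Tendsto (fun p : ℕ => hat M p ^ ((1 : ℝ) / (p : ℝ))) atTop atTop) :
    IsWeightSequence (hat M) where
  pos p := (hM.pos p).trans_le (le_hat hM.pos p)
  zero := by simp [hat, hM.zero]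
  logConvex := by
    intro p hp
    obtain ⟨i, rfl⟩ : ∃ i, p = i + 1 := ⟨p - 1, by omega⟩
    have h := hM.logConvex (i + 1) hp
    simp only [hat, Nat.add_sub_cancel, Nat.factorial_succ] at h ⊢
    push_cast
    have h0 := hM.pos i
    have h2 := hM.pos (i + 1 + 1)
    have hi : (0 : ℝ) ≤ i := Nat.cast_nonneg i
    calc (((i : ℝ) + 1) * i.factorial * M (i + 1)) ^ 2
        = (((i : ℝ) + 1) * i.factorial) * ((i + 1) * i.factorial) * M (i + 1) ^ 2 := by ring
      _ ≤ (((i : ℝ) + 1) * i.factorial) * ((i + 1 + 1) * i.factorial)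
          * (M i * M (i + 1 + 1)) := by gcongr; linarith
      _ = _ := by ring
  root_tendsto := h

theorem isWeightSequence_hat_exSeq : IsWeightSequence (hat exSeq) :=
  isWeightSequence_hat isWeightSequence_exSeq
    (tendsto_root_of_exSeq_le fun p => le_hat exSeq_pos p)

theorem quot_hat {M : ℕ → ℝ} (p : ℕ) : quot (hat M) p = ((p : ℝ) + 1) * quot M p := by
  have h : (p.factorial : ℝ) ≠ 0 := by exact_mod_cast p.factorial_ne_zero
  simp only [quot, hat, Nat.factorial_succ]
  push_cast
  rw [mul_comm (p.factorial : ℝ) (M p), mul_assoc, mul_comm (p.factorial : ℝ) (M (p + 1)),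
    ← mul_assoc, mul_div_mul_right _ _ h, mul_div_assoc]

theorem quot_hat_exSeq (p : ℕ) : quot (hat exSeq) p = ((p : ℝ) + 1) * exQuot p := by
  rw [quot_hat, quot_exSeq]

theorem exQuot_le_quot_hat (p : ℕ) : exQuot p ≤ quot (hat exSeq) p := by
  rw [quot_hat_exSeq]
  exact le_mul_of_one_le_left (exQuot_pos p).le (le_add_of_nonneg_left (Nat.cast_nonneg p))

/-! ### The growth index of sequences -/

/-- Multiplying or dividing the comparison sequence `l` by `p + 1` matches the extra factor in the
quotients and shifts the exponent by one. -/
theorem seqP_hat_iff {M : ℕ → ℝ} {g : ℝ} : SeqP (hat M) g ↔ SeqP M (g - 1) := by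
  have hp : ∀ p : ℕ, (0 : ℝ) < (p : ℝ) + 1 := fun p => by positivity
  have hpow : ∀ p : ℕ, ((p : ℝ) + 1) ^ (-(g - 1)) = ((p : ℝ) + 1) ^ (-g) * ((p : ℝ) + 1) := by
    intro p
    rw [← Real.rpow_add_one (hp p).ne']
    congr 1
    ring
  constructor
  · rintro ⟨l, ⟨a, ha, hl⟩, hmono⟩
    refine ⟨fun p => l p / ((p : ℝ) + 1), ⟨a, ha, fun p => ?_⟩, ?_⟩
    · have h := hl p
      rw [quot_hat] at h
      rw [le_div_iff₀ (hp p), div_le_iff₀ (hp p)]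
      exact ⟨by linarith [h.1], by linarith [h.2]⟩
    · convert hmono using 2 with p
      rw [hpow, mul_assoc, mul_div_cancel₀ _ (hp p).ne']
  · rintro ⟨l, ⟨a, ha, hl⟩, hmono⟩
    refine ⟨fun p => ((p : ℝ) + 1) * l p, ⟨a, ha, fun p => ?_⟩, ?_⟩
    · have h := hl p
      rw [quot_hat]
      have h1 := mul_le_mul_of_nonneg_left h.1 (hp p).le
      have h2 := mul_le_mul_of_nonneg_left h.2 (hp p).le
      exact ⟨by linarith, by linarith⟩
    · convert hmono using 2 with p
      rw [hpow, mul_assoc]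

theorem seqP_exSeq_zero : SeqP exSeq 0 := by
  refine ⟨exQuot, ⟨1, le_rfl, fun p => by simp [quot_exSeq]⟩, ?_⟩
  simpa using exQuot_mono

theorem sub_one_le_div_sq {b : ℕ} : (b : ℝ) - 1 ≤ ((b : ℝ) ^ 2 + 1) / ((b : ℝ) + 1) := by
  rw [le_div_iff₀ (by positivity)]
  nlinarith

/-- At the two ends `b`, `b ^ 2` of a plateau, `l` is within a factor `a` of the same `m_b`, so
monotonicity forces `((b ^ 2 + 1) / (b + 1)) ^ g ≤ a ^ 2`. The left side is at least `(b - 1) ^ g`,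
which is unbounded. -/
theorem not_seqP_exSeq {g : ℝ} (hg : 0 < g) : ¬ SeqP exSeq g := by
  rintro ⟨l, ⟨a, ha, hl⟩, hmono⟩
  have ht : Tendsto (fun b : ℕ => ((b : ℝ) - 1) ^ g) atTop atTop :=
    (tendsto_rpow_atTop hg).comp
      (tendsto_atTop_add_const_right _ (-1) tendsto_natCast_atTop_atTop)
  obtain ⟨n, hn⟩ := eventually_atTop.1 ((ht.eventually_gt_atTop (a ^ 2)).and
    (eventually_ge_atTop 1))
  obtain ⟨b, hb, hq⟩ := exists_exQuot_plateau n
  obtain ⟨h1, hb1⟩ := hn b hb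
  have hbb : b ≤ b ^ 2 := Nat.le_self_pow two_ne_zero b
  have h2 := hmono hbb
  have h3 := (hl b).1
  have h4 := (hl (b ^ 2)).2
  rw [quot_exSeq] at h3 h4
  rw [hq _ hbb le_rfl] at h4
  have hm := exQuot_pos b
  have ha0 : 0 < a := by linarith
  have hx : (0 : ℝ) < (b : ℝ) + 1 := by positivity
  have hy : (0 : ℝ) < (b : ℝ) ^ 2 + 1 := by positivity
  simp only [Nat.cast_pow, Real.rpow_neg hx.le, Real.rpow_neg hy.le] at h2
  have hX := Real.rpow_pos_of_pos hx g
  have hY := Real.rpow_pos_of_pos hy g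
  have hb1' : (1 : ℝ) ≤ b := by exact_mod_cast hb1
  have h5 : ((b : ℝ) - 1) ^ g ≤ ((b : ℝ) ^ 2 + 1) ^ g / ((b : ℝ) + 1) ^ g := by
    rw [← Real.div_rpow hy.le hx.le]
    exact Real.rpow_le_rpow (by linarith) sub_one_le_div_sq hg.le
  have h6 : a ^ 2 * ((b : ℝ) + 1) ^ g < ((b : ℝ) ^ 2 + 1) ^ g :=
    (lt_div_iff₀ hX).1 (h1.trans_le h5)
  have h7 : ((b : ℝ) ^ 2 + 1) ^ g * (a⁻¹ * exQuot b) ≤ ((b : ℝ) + 1) ^ g * (a * exQuot b) := by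
    calc ((b : ℝ) ^ 2 + 1) ^ g * (a⁻¹ * exQuot b) ≤ ((b : ℝ) ^ 2 + 1) ^ g * l b := by gcongr
      _ = ((b : ℝ) + 1) ^ g * ((b : ℝ) ^ 2 + 1) ^ g * ((((b : ℝ) + 1) ^ g)⁻¹ * l b) := by
          field_simp
      _ ≤ ((b : ℝ) + 1) ^ g * ((b : ℝ) ^ 2 + 1) ^ g *
            ((((b : ℝ) ^ 2 + 1) ^ g)⁻¹ * l (b ^ 2)) := by gcongr
      _ = ((b : ℝ) + 1) ^ g * l (b ^ 2) := by field_simp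
      _ ≤ _ := by gcongr
  have h8 : ((b : ℝ) ^ 2 + 1) ^ g ≤ a ^ 2 * ((b : ℝ) + 1) ^ g := by
    have h9 : a * exQuot b * ((b : ℝ) ^ 2 + 1) ^ g * a⁻¹ ≤
        a * exQuot b * (a * ((b : ℝ) + 1) ^ g) := by
      calc _ = a * (((b : ℝ) ^ 2 + 1) ^ g * (a⁻¹ * exQuot b)) := by ring
        _ ≤ a * (((b : ℝ) + 1) ^ g * (a * exQuot b)) := by gcongr
        _ = _ := by ring
    rw [mul_assoc] at h9
    have h10 := le_of_mul_le_mul_left h9 (mul_pos ha0 hm)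
    rw [← div_eq_mul_inv, div_le_iff₀ ha0] at h10
    linarith
  linarith

theorem gammaSeq_eq {M : ℕ → ℝ} {c : ℝ} (h1 : SeqP M c) (h2 : ∀ g > c, ¬ SeqP M g) :
    gammaSeq M = c := by
  refine le_antisymm (sSup_le ?_) (le_sSup ⟨c, h1, rfl⟩)
  rintro _ ⟨g, hg, rfl⟩
  exact EReal.coe_le_coe_iff.2 (not_lt.1 fun h => h2 g h hg)

theorem gammaSeq_exSeq : gammaSeq exSeq = 0 :=
  gammaSeq_eq seqP_exSeq_zero fun _ hg => not_seqP_exSeq hg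

theorem gammaSeq_hat_exSeq : gammaSeq (hat exSeq) = 1 :=
  gammaSeq_eq (seqP_hat_iff.2 (by simpa using seqP_exSeq_zero)) fun g hg h =>
    not_seqP_exSeq (sub_pos.2 hg) (seqP_hat_iff.1 h)

/-! ### Failure of (snq), (γ₁) and (mg) -/

theorem log_sub_log_le_sum (b n : ℕ) :
    Real.log ((b : ℝ) + n + 1) - Real.log ((b : ℝ) + 1) ≤
      ∑ i ∈ Finset.range n, 1 / ((b : ℝ) + i + 1) := by
  induction n with
  | zero => simp
  | succ n ih =>
    rw [Finset.sum_range_succ]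
    have hk : (0 : ℝ) < (b : ℝ) + n + 1 := by positivity
    have h := Real.log_le_sub_one_of_pos
      (show 0 < ((b : ℝ) + n + 1 + 1) / ((b : ℝ) + n + 1) by positivity)
    rw [Real.log_div (by positivity) hk.ne', add_div, div_self hk.ne'] at h
    push_cast
    rw [← add_assoc]
    linarith

/-- Common obstruction to (snq) for `M` and (γ₁) for the quotients of `hat M`: the plateau starting
at `b` alone contributes at least `log (b - 1) / m_b`. -/
theorem not_tsum_le_div_exQuot (B : ℝ)
    (hs : Summable fun q : ℕ => 1 / (((q : ℝ) + 1) * exQuot q)) :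
    ∃ p : ℕ, B / exQuot p < ∑' i : ℕ, 1 / ((((p + i : ℕ) : ℝ) + 1) * exQuot (p + i)) := by
  have ht : Tendsto (fun b : ℕ => Real.log ((b : ℝ) - 1)) atTop atTop :=
    Real.tendsto_log_atTop.comp
      (tendsto_atTop_add_const_right _ (-1) tendsto_natCast_atTop_atTop)
  obtain ⟨n, hn⟩ := eventually_atTop.1 ((ht.eventually_gt_atTop B).and (eventually_ge_atTop 2))
  obtain ⟨b, hb, hq⟩ := exists_exQuot_plateau n
  obtain ⟨h1, hb2⟩ := hn b hb
  have hbb : b ≤ b ^ 2 := Nat.le_self_pow two_ne_zero b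
  refine ⟨b, ?_⟩
  have hb2' : (2 : ℝ) ≤ b := by exact_mod_cast hb2
  have h2 : B < ∑ i ∈ Finset.range (b ^ 2 - b), 1 / ((b : ℝ) + i + 1) := by
    refine lt_of_lt_of_le ?_ (log_sub_log_le_sum b (b ^ 2 - b))
    rw [← Real.log_div (by positivity) (by positivity), Nat.cast_sub hbb]
    push_cast
    rw [add_sub_cancel]
    exact h1.trans_le (Real.log_le_log (by linarith) sub_one_le_div_sq)
  calc B / exQuot b < (∑ i ∈ Finset.range (b ^ 2 - b), 1 / ((b : ℝ) + i + 1)) / exQuot b :=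
        div_lt_div_of_pos_right h2 (exQuot_pos b)
    _ = ∑ i ∈ Finset.range (b ^ 2 - b), 1 / ((((b + i : ℕ) : ℝ) + 1) * exQuot (b + i)) := by
        rw [Finset.sum_div]
        refine Finset.sum_congr rfl fun i hi => ?_
        rw [Finset.mem_range] at hi
        rw [hq (b + i) (by omega) (by omega), div_div]
        push_cast
        rfl
    _ ≤ _ := by
        refine Summable.sum_le_tsum _ (fun i _ => ?_)
          (hs.comp_injective (add_right_injective b))
        have := exQuot_pos (b + i)
        positivity

theorem not_strongNonquasianalytic_exSeq : ¬ StrongNonquasianalytic exSeq := by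
  rintro ⟨B, -, hs, hB⟩
  have hterm : ∀ q : ℕ, exSeq q / (((q : ℝ) + 1) * exSeq (q + 1)) =
      1 / (((q : ℝ) + 1) * exQuot q) := by
    intro q
    rw [exSeq_succ, mul_left_comm, ← div_div, div_self (exSeq_pos q).ne']
  simp only [hterm] at hs
  obtain ⟨p, hp⟩ := not_tsum_le_div_exQuot B hs
  have h := hB p
  simp only [hterm] at h
  rw [exSeq_succ, ← div_div, div_self (exSeq_pos p).ne', mul_one_div] at h
  linarith

theorem not_gammaOne_quot_hat_exSeq : ¬ GammaOne (quot (hat exSeq)) := by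
  rintro ⟨C, -, hs, hC⟩
  simp only [quot_hat_exSeq] at hs
  obtain ⟨p, hp⟩ := not_tsum_le_div_exQuot C hs
  have h := hC p
  simp only [quot_hat_exSeq] at h
  rw [mul_comm C, mul_div_mul_left _ _ (by positivity)] at h
  linarith

/-- The case `q = 1` of (mg) would bound `log m_p` by an affine function of `p`. -/
theorem not_moderateGrowth_of_exQuot_le {M : ℕ → ℝ} (hM : ∀ p, 0 < M p)
    (h : ∀ p, exQuot p ≤ quot M p) : ¬ ModerateGrowth M := by
  rintro ⟨A, hA, hmg⟩
  have h1 : ∀ p : ℕ, deltaSum p ≤ (p + 1) * Real.log A + Real.log (M 1) := by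
    intro p
    have h2 : exQuot p ≤ A ^ (p + 1) * M 1 := by
      refine (h p).trans ((div_le_iff₀ (hM p)).2 ?_)
      linarith [hmg p 1]
    have h3 := Real.log_le_log (exQuot_pos p) h2
    rw [log_exQuot, Real.log_mul (by positivity) (hM 1).ne', Real.log_pow] at h3
    exact_mod_cast h3
  obtain ⟨p, hp, hp1⟩ := ((tendsto_deltaSum_div.eventually_gt_atTop
    (2 * |Real.log A| + |Real.log (M 1)|)).and (eventually_ge_atTop 1)).exists
  have hp1' : (1 : ℝ) ≤ p := by exact_mod_cast hp1
  rw [lt_div_iff₀ (by linarith)] at hp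
  have h4 := h1 p
  have h5 := le_abs_self (Real.log A)
  have h6 := le_abs_self (Real.log (M 1))
  have h7 := abs_nonneg (Real.log A)
  have h8 := abs_nonneg (Real.log (M 1))
  nlinarith

/-! ### Indices of the quotients -/

theorem omegaSeq_eq_top {M : ℕ → ℝ} (h : ∀ p, exQuot p ≤ quot M p) : omegaSeq M = ⊤ := by
  refine Tendsto.liminf_eq (EReal.tendsto_coe_nhds_top_iff.2 ?_)
  have h1 : Tendsto (fun p : ℕ => deltaSum p / p) atTop atTop := tendsto_deltaSum_div
  refine tendsto_atTop_mono' _ ?_ h1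
  filter_upwards [eventually_ge_atTop 2] with p hp
  have hp' : (1 : ℝ) < p := by exact_mod_cast hp
  have h2 : deltaSum p ≤ Real.log (quot M p) := by
    rw [← log_exQuot]
    exact Real.log_le_log (exQuot_pos p) (h p)
  exact div_le_div₀ ((deltaSum_nonneg p).trans h2) h2 (Real.log_pos hp')
    (Real.log_le_self (by linarith))

theorem upperOrder_quotStep_eq_top {M : ℕ → ℝ} (h : ∀ p, exQuot p ≤ quot M p) :
    upperOrder (quotStep M) = ⊤ := by
  refine Tendsto.limsup_eq (EReal.tendsto_coe_nhds_top_iff.2 ?_)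
  have h0 : Tendsto (fun x : ℝ => ⌊x⌋₊ - 1) atTop atTop :=
    (tendsto_sub_atTop_nat 1).comp tendsto_nat_floor_atTop
  -- The 3 comes from `log x ≤ x < p + 2 ≤ 3 * p`, where `p = ⌊x⌋₊ - 1 ≥ 1`.
  have h1 := (tendsto_deltaSum_div.comp h0).atTop_div_const (show (0 : ℝ) < 3 by norm_num)
  refine tendsto_atTop_mono' _ ?_ h1
  filter_upwards [eventually_ge_atTop 2] with x hx
  have hfl : 2 ≤ ⌊x⌋₊ := Nat.le_floor hx
  have hlt := Nat.lt_floor_add_one x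
  set p := ⌊x⌋₊ - 1 with hpdef
  have hfp : ⌊x⌋₊ = p + 1 := by omega
  have hp1 : (1 : ℝ) ≤ p := by exact_mod_cast (by omega : 1 ≤ p)
  rw [hfp] at hlt
  push_cast at hlt
  have h2 : deltaSum p ≤ Real.log (quotStep M x) := by
    rw [← log_exQuot]
    exact Real.log_le_log (exQuot_pos p) (h p)
  simp only [Function.comp_apply, div_div]
  rw [← hpdef]
  refine div_le_div₀ ((deltaSum_nonneg p).trans h2) h2 (Real.log_pos (by linarith)) ?_
  exact (Real.log_le_self (by linarith)).trans (by linarith)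

/-- No exponent is admissible, already for `L = 2`: at `x = k + 1`, with a jump starting at `k`, the
ratio for `l = 2` compares the quotients at `2 * k + 1` and `k`, and is at least `exp (16 * k ^ 3) /
2 ^ a`. -/
theorem upperMatuszewska_quotStep_eq_top {M : ℕ → ℝ} (hpos : ∀ p, 0 < quot M p)
    (h : ∀ p q, p ≤ q → exQuot q / exQuot p ≤ quot M q / quot M p) :
    upperMatuszewska (quotStep M) = ⊤ := by
  rw [upperMatuszewska, sInf_eq_top]
  rintro _ ⟨a, ⟨C, hC, hL⟩, rfl⟩
  exfalso
  have h1 : limsup (fun x : ℝ => ⨆ l ∈ Set.Icc (1 : ℝ) 2,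
      ((quotStep M (l * x) / (l ^ a * quotStep M x) : ℝ) : EReal)) atTop <
      ((C + 1 : ℝ) : EReal) :=
    (hL 2 one_lt_two).trans_lt (EReal.coe_lt_coe_iff.2 (lt_add_one C))
  obtain ⟨X, hX⟩ := eventually_atTop.1 (eventually_lt_of_limsup_lt h1)
  obtain ⟨n, hn⟩ := exists_nat_ge (max X ((C + 1) * 2 ^ a))
  obtain ⟨k, hk, hjump⟩ := exists_deltaSum_jump (n + 1)
  have hkn : (n : ℝ) + 1 ≤ k := by exact_mod_cast hk
  have hXn := (le_max_left _ _).trans hn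
  have hCn := (le_max_right _ _).trans hn
  have h2 := (le_iSup₂ (f := fun l (_ : l ∈ Set.Icc (1 : ℝ) 2) =>
    ((quotStep M (l * ((k + 1 : ℕ) : ℝ)) / (l ^ a * quotStep M ((k + 1 : ℕ) : ℝ)) : ℝ) : EReal))
    2 ⟨one_le_two, le_rfl⟩).trans_lt (hX ((k + 1 : ℕ) : ℝ) (by push_cast; linarith))
  rw [EReal.coe_lt_coe_iff] at h2
  have e1 : quotStep M ((k + 1 : ℕ) : ℝ) = quot M k := by
    rw [quotStep, Nat.floor_natCast, Nat.add_sub_cancel]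
  have e2 : quotStep M (2 * ((k + 1 : ℕ) : ℝ)) = quot M (2 * k + 1) := by
    have : (2 * ((k + 1 : ℕ) : ℝ)) = ((2 * k + 1 + 1 : ℕ) : ℝ) := by push_cast; ring
    rw [quotStep, this, Nat.floor_natCast, Nat.add_sub_cancel]
  rw [e1, e2, div_lt_iff₀ (mul_pos (by positivity) (hpos k)), ← mul_assoc,
    ← div_lt_iff₀ (hpos k)] at h2
  have h3 := h k (2 * k + 1) (by omega)
  have h4 : 16 * (k : ℝ) ^ 3 + 1 ≤ exQuot (2 * k + 1) / exQuot k := by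
    rw [exQuot_eq, exQuot_eq, ← Real.exp_sub]
    have h5 := deltaSum_mono (Nat.le_succ (2 * k))
    refine (Real.add_one_le_exp _).trans (Real.exp_le_exp.2 ?_)
    simp only [Nat.succ_eq_add_one] at h5
    linarith
  have hk1 : (1 : ℝ) ≤ k := by linarith [show (0 : ℝ) ≤ n from Nat.cast_nonneg n]
  have h6 : (k : ℝ) ≤ (k : ℝ) ^ 3 := le_self_pow₀ hk1 (by norm_num)
  linarith

theorem exQuot_div_le_quot_hat_div (p q : ℕ) (hpq : p ≤ q) :
    exQuot q / exQuot p ≤ quot (hat exSeq) q / quot (hat exSeq) p := by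
  have hp := exQuot_pos p
  have hq := exQuot_pos q
  have h : (p : ℝ) ≤ q := by exact_mod_cast hpq
  rw [quot_hat_exSeq, quot_hat_exSeq, div_le_div_iff₀ hp (by positivity)]
  calc exQuot q * (((p : ℝ) + 1) * exQuot p) ≤ exQuot q * (((q : ℝ) + 1) * exQuot p) := by gcongr
    _ = _ := by ring


/-! ### Indices of slowly varying monotone functions -/

section SlowlyVarying

variable {f : ℝ → ℝ}

theorem lowerMatuszewska_eq_zero (hmono : MonotoneOn f (Ioi 0)) (htop : Tendsto f atTop atTop)
    (hslow : ∀ L : ℝ, 1 < L → ∀ ε : ℝ, 0 < ε → ∀ᶠ x in atTop, f (L * x) ≤ (1 + ε) * f x) :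
    lowerMatuszewska f = 0 := by
  refine le_antisymm (sSup_le ?_) (le_sSup ⟨0, ⟨1, one_pos, fun L hL => ?_⟩, rfl⟩)
  · rintro _ ⟨b, ⟨D, hD, h⟩, rfl⟩
    refine EReal.coe_le_coe_iff.2 (not_lt.1 fun hb => ?_)
    -- Slow variation gives `f (L * x) ≤ 2 * f x`, whereas the exponent `b` would give `D / 2 * L ^
    -- b < 2`, contradicting `L ^ b ≥ 4 / D`.
    obtain ⟨L, hLb, hL⟩ := (((tendsto_rpow_atTop hb).eventually_ge_atTop (4 / D)).and
      (eventually_gt_atTop 1)).exists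
    have h1 : ((D / 2 : ℝ) : EReal) < liminf (fun x : ℝ => ⨅ l ∈ Set.Icc (1 : ℝ) L,
        ((f (l * x) / (l ^ b * f x) : ℝ) : EReal)) atTop :=
      (EReal.coe_lt_coe_iff.2 (half_lt_self hD)).trans_le (h L hL)
    obtain ⟨x, ⟨hx1, hx2⟩, hx3⟩ := (((eventually_lt_of_lt_liminf h1).and
      (hslow L hL 1 one_pos)).and (htop.eventually_gt_atTop 0)).exists
    have h2 := hx1.trans_le (iInf₂_le L ⟨hL.le, le_rfl⟩)
    rw [EReal.coe_lt_coe_iff] at h2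
    have hLp : 0 < L ^ b := Real.rpow_pos_of_pos (by linarith) b
    rw [lt_div_iff₀ (mul_pos hLp hx3), ← mul_assoc] at h2
    have h3 := lt_of_mul_lt_mul_right (h2.trans_le hx2) hx3.le
    rw [div_le_iff₀ hD] at hLb
    linarith
  · refine le_liminf_of_le (by isBoundedDefault) ?_
    filter_upwards [htop.eventually_gt_atTop 0, eventually_gt_atTop 0] with x hx hx0
    refine le_iInf₂ fun l hl => EReal.coe_le_coe_iff.2 ?_
    rw [Real.rpow_zero, one_mul, one_le_div hx]
    have hlx : x ≤ l * x := le_mul_of_one_le_left hx0.le hl.1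
    exact hmono hx0 (hx0.trans_le hlx) hlx

theorem upperMatuszewska_eq_zero (hmono : MonotoneOn f (Ioi 0)) (htop : Tendsto f atTop atTop)
    (hslow : ∀ L : ℝ, 1 < L → ∀ ε : ℝ, 0 < ε → ∀ᶠ x in atTop, f (L * x) ≤ (1 + ε) * f x) :
    upperMatuszewska f = 0 := by
  refine le_antisymm (sInf_le ⟨0, ⟨2, two_pos, fun L hL => ?_⟩, rfl⟩) (le_sInf ?_)
  · refine limsup_le_of_le (by isBoundedDefault) ?_
    filter_upwards [htop.eventually_gt_atTop 0, eventually_gt_atTop 0, hslow L hL 1 one_pos]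
      with x hx hx0 hxL
    refine iSup₂_le fun l hl => EReal.coe_le_coe_iff.2 ?_
    rw [Real.rpow_zero, one_mul, div_le_iff₀ hx]
    have hl0 : 0 < l := one_pos.trans_le hl.1
    have h1 : f (l * x) ≤ f (L * x) :=
      hmono (mul_pos hl0 hx0) (mul_pos (by linarith) hx0) (by gcongr; exact hl.2)
    linarith
  · rintro _ ⟨a, ⟨C, hC, h⟩, rfl⟩
    refine EReal.coe_le_coe_iff.2 (not_lt.1 fun ha => ?_)
    obtain ⟨L, hLa, hL⟩ := (((tendsto_rpow_atTop (neg_pos.2 ha)).eventually_ge_atTop (C + 1)).and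
      (eventually_gt_atTop 1)).exists
    have h1 : limsup (fun x : ℝ => ⨆ l ∈ Set.Icc (1 : ℝ) L,
        ((f (l * x) / (l ^ a * f x) : ℝ) : EReal)) atTop < ((C + 1 : ℝ) : EReal) :=
      (h L hL).trans_lt (EReal.coe_lt_coe_iff.2 (lt_add_one C))
    obtain ⟨x, ⟨hx1, hx0⟩, hx⟩ := (((eventually_lt_of_limsup_lt h1).and
      (eventually_gt_atTop 0)).and (htop.eventually_gt_atTop 0)).exists
    have h2 := (le_iSup₂ (f := fun l (_ : l ∈ Set.Icc (1 : ℝ) L) =>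
      ((f (l * x) / (l ^ a * f x) : ℝ) : EReal)) L ⟨hL.le, le_rfl⟩).trans_lt hx1
    rw [EReal.coe_lt_coe_iff] at h2
    have hL0 : 0 < L := by linarith
    have hLx : x ≤ L * x := le_mul_of_one_le_left hx0.le hL.le
    have h3 : L ^ (-a) ≤ f (L * x) / (L ^ a * f x) := by
      rw [le_div_iff₀ (mul_pos (Real.rpow_pos_of_pos hL0 a) hx), ← mul_assoc,
        ← Real.rpow_add hL0, neg_add_cancel, Real.rpow_zero, one_mul]
      exact hmono hx0 (mul_pos hL0 hx0) hLx
    linarith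

/-- For every exponent `K = 2` works, the limsup being at most `3 / 2`. -/
theorem gammaFun_eq_top (htop : Tendsto f atTop atTop)
    (hslow : ∀ L : ℝ, 1 < L → ∀ ε : ℝ, 0 < ε → ∀ᶠ x in atTop, f (L * x) ≤ (1 + ε) * f x) :
    gammaFun f = ⊤ := by
  refine EReal.eq_top_iff_forall_lt _ |>.2 fun y => ?_
  refine lt_of_lt_of_le (EReal.coe_lt_coe_iff.2 (lt_of_le_of_lt (le_abs_self y)
    (lt_add_one |y|))) (le_max_of_le_right (le_sSup ⟨|y| + 1, ⟨by positivity, 2, one_lt_two, ?_⟩,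
      rfl⟩))
  refine lt_of_le_of_lt (b := ((3 / 2 : ℝ) : EReal)) ?_
    (EReal.coe_lt_coe_iff.2 (by norm_num))
  refine limsup_le_of_le (by isBoundedDefault) ?_
  filter_upwards [htop.eventually_gt_atTop 0,
    hslow (2 ^ (|y| + 1)) (Real.one_lt_rpow one_lt_two (by positivity)) (1 / 2) (by norm_num)]
    with x hx hxL
  rw [EReal.coe_le_coe_iff, div_le_iff₀ hx]
  linarith

end SlowlyVarying

/-! ### The associated function of a weight sequence with rapidly growing quotients -/

section Assoc

variable {M : ℕ → ℝ}

theorem IsWeightSequence.quot_pos (hM : IsWeightSequence M) (p : ℕ) : 0 < quot M p :=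
  div_pos (hM.pos _) (hM.pos _)

theorem IsWeightSequence.quot_mono (hM : IsWeightSequence M) : Monotone (quot M) :=
  monotone_nat_of_le_succ fun p => by
    have h := hM.logConvex (p + 1) (by omega)
    rw [Nat.add_sub_cancel] at h
    rw [quot, quot, div_le_div_iff₀ (hM.pos _) (hM.pos _)]
    linarith

theorem assoc_eq_iSup {t : ℝ} (ht : 0 < t) : assoc M t = ⨆ p : ℕ, Real.log (t ^ p / M p) :=
  if_neg ht.ne'

theorem IsWeightSequence.log_le_assoc (hM : IsWeightSequence M) {t : ℝ} (ht : 0 < t) (p : ℕ) :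
    Real.log (t ^ p / M p) ≤ assoc M t := by
  rw [assoc_eq_iSup ht]
  exact le_ciSup (hM.bddAbove_log ht) p

theorem IsWeightSequence.assoc_nonneg (hM : IsWeightSequence M) {t : ℝ} (ht : 0 < t) :
    0 ≤ assoc M t := by
  simpa [hM.zero] using hM.log_le_assoc ht 0

theorem IsWeightSequence.log_sub_le_assoc (hM : IsWeightSequence M) {t : ℝ} (ht : 0 < t) :
    Real.log t - Real.log (M 1) ≤ assoc M t := by
  have h := hM.log_le_assoc ht 1
  rwa [pow_one, Real.log_div ht.ne' (hM.pos 1).ne'] at h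

theorem IsWeightSequence.monotoneOn_assoc (hM : IsWeightSequence M) :
    MonotoneOn (assoc M) (Ioi 0) := by
  intro x hx y hy hxy
  rw [mem_Ioi] at hx hy
  rw [assoc_eq_iSup hx]
  refine ciSup_le fun p => le_trans ?_ (hM.log_le_assoc hy p)
  have := hM.pos p
  exact Real.log_le_log (by positivity) (by gcongr)

theorem IsWeightSequence.tendsto_assoc (hM : IsWeightSequence M) :
    Tendsto (assoc M) atTop atTop := by
  refine tendsto_atTop_mono' _ ?_
    (tendsto_atTop_add_const_right _ (-Real.log (M 1)) Real.tendsto_log_atTop)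
  filter_upwards [eventually_gt_atTop 0] with x hx
  exact hM.log_sub_le_assoc hx

theorem IsWeightSequence.pow_div_le_of_le_quot (hM : IsWeightSequence M) {t : ℝ} (ht : 0 < t)
    {n p : ℕ} (hn : t ≤ quot M n) (hnp : n ≤ p) : t ^ p / M p ≤ t ^ n / M n := by
  induction p, hnp using Nat.le_induction with
  | base => rfl
  | succ p hp ih =>
    refine le_trans ?_ ih
    have h1 := (le_div_iff₀ (hM.pos p)).1 (hn.trans (hM.quot_mono hp))
    rw [div_le_div_iff₀ (hM.pos _) (hM.pos _), pow_succ, mul_assoc]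
    gcongr

/-- Beyond `n` the terms `(l * x) ^ p / M p` no longer increase, so only `p ≤ n` matters, and for
these the factor `l ^ p` costs at most `n * log l`. -/
theorem IsWeightSequence.assoc_mul_le (hM : IsWeightSequence M) {x l : ℝ} (hx : 0 < x)
    (hl : 1 ≤ l) {n : ℕ} (hn : l * x ≤ quot M n) :
    assoc M (l * x) ≤ assoc M x + n * Real.log l := by
  have hl0 : 0 < l := one_pos.trans_le hl
  have key : ∀ p ≤ n, Real.log ((l * x) ^ p / M p) ≤ assoc M x + n * Real.log l := by
    intro p hp
    have h1 := hM.log_le_assoc hx p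
    have h2 := hM.pos p
    have h3 : (p : ℝ) * Real.log l ≤ n * Real.log l := by
      gcongr
      exact Real.log_nonneg hl
    rw [mul_pow, mul_div_assoc, Real.log_mul (by positivity) (by positivity), Real.log_pow]
    linarith
  rw [assoc_eq_iSup (mul_pos hl0 hx)]
  refine ciSup_le fun p => ?_
  rcases le_total p n with hp | hp
  · exact key p hp
  · have h2 := hM.pos p
    exact (Real.log_le_log (by positivity)
      (hM.pow_div_le_of_le_quot (mul_pos hl0 hx) hn hp)).trans (key n le_rfl)

theorem IsWeightSequence.exists_sub_le_log_quot (hM : IsWeightSequence M)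
    (H : Tendsto (fun p : ℕ => Real.log (quot M p) / p) atTop atTop) :
    ∃ K : ℝ, 0 ≤ K ∧ ∀ p : ℕ, (p : ℝ) - K ≤ Real.log (quot M p) := by
  obtain ⟨N, hN⟩ := eventually_atTop.1 ((H.eventually_ge_atTop 1).and (eventually_gt_atTop 0))
  refine ⟨N + |Real.log (quot M 0)|, by positivity, fun p => ?_⟩
  have h0 := abs_nonneg (Real.log (quot M 0))
  rcases le_total N p with h | h
  · obtain ⟨h1, h2⟩ := hN p h
    rw [one_le_div (by exact_mod_cast h2)] at h1
    linarith [show (0 : ℝ) ≤ N from Nat.cast_nonneg N]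
  · have h1 := Real.log_le_log (hM.quot_pos 0) (hM.quot_mono (Nat.zero_le p))
    have h2 := neg_abs_le (Real.log (quot M 0))
    have h3 : (p : ℝ) ≤ N := by exact_mod_cast h
    linarith

/-- Taking `n` about `log (l * x) + K` is enough because `log m_n ≥ n - K`; then `log x` is absorbed
by `ω_M x + log M_1`. -/
theorem IsWeightSequence.exists_assoc_mul_le (hM : IsWeightSequence M)
    (H : Tendsto (fun p : ℕ => Real.log (quot M p) / p) atTop atTop) :
    ∃ K : ℝ, 0 ≤ K ∧ ∀ x l : ℝ, 0 < x → 1 ≤ l →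
      assoc M (l * x) ≤ assoc M x + Real.log l * (assoc M x + Real.log l + K) := by
  obtain ⟨K, hK, h⟩ := hM.exists_sub_le_log_quot H
  refine ⟨K + |Real.log (M 1)| + 1, by positivity, fun x l hx hl => ?_⟩
  have hl0 : 0 < l := one_pos.trans_le hl
  have hlog := Real.log_nonneg hl
  set n := ⌈max 0 (Real.log (l * x) + K)⌉₊ with hndef
  have hn1 : max 0 (Real.log (l * x) + K) ≤ n := Nat.le_ceil _
  have hn2 : (n : ℝ) < max 0 (Real.log (l * x) + K) + 1 := Nat.ceil_lt_add_one (le_max_left _ _)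
  have hn3 : l * x ≤ quot M n := by
    rw [← Real.log_le_log_iff (mul_pos hl0 hx) (hM.quot_pos n)]
    linarith [h n, le_max_right 0 (Real.log (l * x) + K)]
  refine (hM.assoc_mul_le hx hl hn3).trans ?_
  rw [mul_comm]
  gcongr
  refine hn2.le.trans ?_
  rw [← add_assoc, ← add_assoc]
  gcongr
  have h1 := hM.assoc_nonneg hx
  have h2 := hM.log_sub_le_assoc hx
  have h3 := le_abs_self (Real.log (M 1))
  have h4 := abs_nonneg (Real.log (M 1))
  rw [Real.log_mul hl0.ne' hx.ne']
  exact max_le (by linarith) (by linarith)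

theorem IsWeightSequence.eventually_assoc_mul_le (hM : IsWeightSequence M)
    (H : Tendsto (fun p : ℕ => Real.log (quot M p) / p) atTop atTop)
    (L : ℝ) (hL : 1 < L) (ε : ℝ) (hε : 0 < ε) :
    ∀ᶠ x in atTop, assoc M (L * x) ≤ (1 + ε) * assoc M x := by
  have hL0 : 0 < L := by linarith
  have hlog := Real.log_pos hL
  -- With `n` about `η * log (L * x)`, the cost `n * log L` is about `ε / 2 * log x`; the other half
  -- of `ε` absorbs the constants through the lower bound imposed on `log x` below.
  set η := ε / (2 * Real.log L) with hη
  have hη0 : 0 < η := by positivity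
  have hηL : η * Real.log L = ε / 2 := by
    rw [hη]
    field_simp
  obtain ⟨N, hN⟩ := eventually_atTop.1 ((H.eventually_ge_atTop η⁻¹).and (eventually_gt_atTop 0))
  filter_upwards [eventually_gt_atTop 0, Real.tendsto_log_atTop.eventually_ge_atTop (N / η),
    Real.tendsto_log_atTop.eventually_ge_atTop
      (Real.log L + 2 * Real.log L / ε + 2 * Real.log (M 1))] with x hx hx1 hx2
  have hlogx : 0 ≤ Real.log x := le_trans (by positivity) hx1
  have hlogLx := Real.log_mul hL0.ne' hx.ne'
  set n := ⌈η * Real.log (L * x)⌉₊ with hndef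
  have hn1 : η * Real.log (L * x) ≤ n := Nat.le_ceil _
  have hn2 : (n : ℝ) < η * Real.log (L * x) + 1 :=
    Nat.ceil_lt_add_one (by rw [hlogLx]; positivity)
  rw [hlogLx] at hn1 hn2
  have hNn : N ≤ n := by
    rw [div_le_iff₀ hη0] at hx1
    have : (N : ℝ) ≤ n := by nlinarith
    exact_mod_cast this
  obtain ⟨h1, h2⟩ := hN n hNn
  have h2' : (0 : ℝ) < n := by exact_mod_cast h2
  have hn3 : L * x ≤ quot M n := by
    rw [← Real.log_le_log_iff (mul_pos hL0 hx) (hM.quot_pos n), hlogLx]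
    rw [le_div_iff₀ h2', inv_mul_le_iff₀ hη0] at h1
    exact le_of_mul_le_mul_left (hn1.trans h1) hη0
  refine (hM.assoc_mul_le hx hL.le hn3).trans ?_
  have h3 := hM.log_sub_le_assoc hx
  have h4 : (n : ℝ) * Real.log L ≤ ε / 2 * (Real.log L + Real.log x) + Real.log L := by
    calc (n : ℝ) * Real.log L ≤ (η * (Real.log L + Real.log x) + 1) * Real.log L := by gcongr
      _ = η * Real.log L * (Real.log L + Real.log x) + Real.log L := by ring
      _ = _ := by rw [hηL]
  have h5 : ε * (Real.log L + 2 * Real.log L / ε + 2 * Real.log (M 1)) ≤ ε * Real.log x := by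
    gcongr
  have h6 : ε * (Real.log L + 2 * Real.log L / ε + 2 * Real.log (M 1)) =
      ε * Real.log L + 2 * Real.log L + 2 * ε * Real.log (M 1) := by
    field_simp
  have h7 := mul_le_mul_of_nonneg_left h3 hε.le
  linarith

theorem IsWeightSequence.tendsto_log_assoc_div_log (hM : IsWeightSequence M)
    (H : Tendsto (fun p : ℕ => Real.log (quot M p) / p) atTop atTop) :
    Tendsto (fun x : ℝ => Real.log (assoc M x) / Real.log x) atTop (𝓝 0) := by
  obtain ⟨K, hK, h⟩ := hM.exists_assoc_mul_le H
  have h1 : Tendsto (fun x : ℝ => 4 * (Real.log (Real.log x) / Real.log x)) atTop (𝓝 0) := by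
    simpa using ((Real.isLittleO_log_id_atTop.tendsto_div_nhds_zero.comp
      Real.tendsto_log_atTop).const_mul 4)
  refine squeeze_zero' ?_ ?_ h1
  · filter_upwards [eventually_ge_atTop 1, hM.tendsto_assoc.eventually_ge_atTop 1] with x hx hx1
    exact div_nonneg (Real.log_nonneg hx1) (Real.log_nonneg hx)
  · filter_upwards [eventually_ge_atTop 1, hM.tendsto_assoc.eventually_ge_atTop 1,
      Real.tendsto_log_atTop.eventually_ge_atTop (assoc M 1 + K + 2)] with x hx hx1 hx2
    have h0 := hM.assoc_nonneg one_pos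
    -- Base point 1 and dilation `x`: `ω_M x` is at most quadratic in `log x`, and the fourth power
    -- swallows the constants.
    have h2 := h 1 x one_pos hx
    rw [mul_one] at h2
    set u := Real.log x
    have h3 : assoc M x ≤ u ^ 4 := by
      have h4 : u * (assoc M 1 + u + K) ≤ u * (2 * u) := by
        gcongr
        · linarith
        · linarith
      have h5 : 3 * u ^ 2 ≤ u ^ 2 * u ^ 2 := by
        have : 2 ≤ u := by linarith
        gcongr
        nlinarith
      nlinarith
    have h6 := Real.log_le_log (by linarith) h3
    rw [Real.log_pow] at h6
    rw [← mul_div_assoc]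
    exact div_le_div_of_nonneg_right (by exact_mod_cast h6) (by linarith)

theorem IsWeightSequence.lowerOrder_assoc (hM : IsWeightSequence M)
    (H : Tendsto (fun p : ℕ => Real.log (quot M p) / p) atTop atTop) :
    lowerOrder (assoc M) = 0 :=
  ((continuous_coe_real_ereal.tendsto 0).comp (hM.tendsto_log_assoc_div_log H)).liminf_eq

theorem IsWeightSequence.upperOrder_assoc (hM : IsWeightSequence M)
    (H : Tendsto (fun p : ℕ => Real.log (quot M p) / p) atTop atTop) :
    upperOrder (assoc M) = 0 :=
  ((continuous_coe_real_ereal.tendsto 0).comp (hM.tendsto_log_assoc_div_log H)).limsup_eq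

theorem IsWeightSequence.omegaSnq_assoc (hM : IsWeightSequence M)
    (H : Tendsto (fun p : ℕ => Real.log (quot M p) / p) atTop atTop) :
    OmegaSnq (assoc M) := by
  obtain ⟨K, hK, h⟩ := hM.exists_assoc_mul_le H
  -- Since `log t ≤ 4 * t ^ (1 / 4)`, the integrand is at most `(5 * ω_M y + 16 + 4 * K) * t ^ (-3 /
  -- 2)`, with integral `10 * ω_M y + 32 + 8 * K`; the constant `42 + 8 * K` dominates both
  -- coefficients.
  refine ⟨42 + 8 * K, by linarith, fun y hy => ?_⟩
  have hσ := hM.assoc_nonneg hy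
  have hexp : (-(3 / 2) : ℝ) < -1 := by norm_num
  have hbound : ∀ t ∈ Ioi (1 : ℝ), assoc M (y * t) / t ^ 2 ≤
      (5 * assoc M y + 16 + 4 * K) * t ^ (-(3 / 2) : ℝ) := by
    intro t ht
    rw [mem_Ioi] at ht
    have ht0 : 0 < t := by linarith
    have h1 := h y t hy ht.le
    have h2 := Real.log_le_rpow_div ht0.le (show (0 : ℝ) < 1 / 4 by norm_num)
    have hr1 : 1 ≤ t ^ (1 / 4 : ℝ) := Real.one_le_rpow ht.le (by norm_num)
    have hr2 : t ^ (-(3 / 2) : ℝ) * t ^ 2 = (t ^ (1 / 4 : ℝ)) ^ 2 := by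
      rw [← Real.rpow_natCast t 2, ← Real.rpow_add ht0, ← Real.rpow_natCast (t ^ (1 / 4 : ℝ)),
        ← Real.rpow_mul ht0.le]
      norm_num
    set r := t ^ (1 / 4 : ℝ)
    have h3 : Real.log t ≤ 4 * r := by linarith
    have hlog := Real.log_nonneg ht.le
    rw [div_le_iff₀ (by positivity), mul_assoc, hr2, mul_comm y]
    have hr3 : r ≤ r ^ 2 := le_self_pow₀ hr1 two_ne_zero
    calc assoc M (t * y) ≤ assoc M y + Real.log t * (assoc M y + Real.log t + K) := h1
      _ ≤ assoc M y + 4 * r * (assoc M y + 4 * r + K) := by gcongr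
      _ = assoc M y * 1 + 4 * assoc M y * r + 16 * r ^ 2 + 4 * K * r := by ring
      _ ≤ assoc M y * r ^ 2 + 4 * assoc M y * r ^ 2 + 16 * r ^ 2 + 4 * K * r ^ 2 := by
          gcongr
          exact hr1.trans hr3
      _ = (5 * assoc M y + 16 + 4 * K) * r ^ 2 := by ring
  have hg : IntegrableOn (fun t : ℝ => (5 * assoc M y + 16 + 4 * K) * t ^ (-(3 / 2) : ℝ))
      (Ioi 1) := (integrableOn_Ioi_rpow_of_lt hexp one_pos).const_mul _
  have hmeas : AEStronglyMeasurable (fun t : ℝ => assoc M (y * t) / t ^ 2)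
      (volume.restrict (Ioi 1)) := by
    have hm : MonotoneOn (fun t : ℝ => assoc M (y * t)) (Ioi 1) := by
      intro s hs t ht hst
      rw [mem_Ioi] at hs ht
      exact hM.monotoneOn_assoc (mul_pos hy (by linarith)) (mul_pos hy (by linarith))
        (by gcongr)
    exact ((aemeasurable_restrict_of_monotoneOn measurableSet_Ioi hm).div
      (by fun_prop)).aestronglyMeasurable
  have hint : IntegrableOn (fun t : ℝ => assoc M (y * t) / t ^ 2) (Ioi 1) := by
    refine Integrable.mono' hg hmeas ((ae_restrict_iff' measurableSet_Ioi).2 (ae_of_all _ ?_))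
    intro t ht
    have h0 := hM.assoc_nonneg (mul_pos hy (one_pos.trans ht))
    rw [Real.norm_of_nonneg (by positivity)]
    exact hbound t ht
  refine ⟨hint, (setIntegral_mono_on hint hg measurableSet_Ioi hbound).trans ?_⟩
  rw [integral_const_mul, integral_Ioi_rpow_of_lt hexp one_pos, Real.one_rpow]
  norm_num
  nlinarith [mul_nonneg hK hσ]

theorem IsWeightSequence.indices_assoc (hM : IsWeightSequence M)
    (H : Tendsto (fun p : ℕ => Real.log (quot M p) / p) atTop atTop) :
    lowerMatuszewska (assoc M) = 0 ∧ lowerOrder (assoc M) = 0 ∧ upperOrder (assoc M) = 0 ∧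
      upperMatuszewska (assoc M) = 0 ∧ gammaFun (assoc M) = ⊤ ∧ OmegaSnq (assoc M) :=
  have hs := hM.eventually_assoc_mul_le H
  ⟨lowerMatuszewska_eq_zero hM.monotoneOn_assoc hM.tendsto_assoc hs, hM.lowerOrder_assoc H,
    hM.upperOrder_assoc H, upperMatuszewska_eq_zero hM.monotoneOn_assoc hM.tendsto_assoc hs,
    gammaFun_eq_top hM.tendsto_assoc hs, hM.omegaSnq_assoc H⟩

end Assoc

theorem tendsto_log_quot_div {M : ℕ → ℝ} (h : ∀ p, exQuot p ≤ quot M p) :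
    Tendsto (fun p : ℕ => Real.log (quot M p) / p) atTop atTop := by
  refine tendsto_atTop_mono (fun p => ?_) tendsto_deltaSum_div
  rw [← log_exQuot]
  exact div_le_div_of_nonneg_right (Real.log_le_log (exQuot_pos p) (h p)) (Nat.cast_nonneg p)

end WeightIndices

theorem mainTheorem12 :
    -- `M` is a weight sequence with the prescribed quotients, and so `(p! M_p)_p` is one
    (IsWeightSequence exSeq ∧ (∀ p, quot exSeq p = exQuot p) ∧ IsWeightSequence (hat exSeq)) ∧
    -- (i)
    (gammaSeq exSeq = 0 ∧ gammaSeq (hat exSeq) = 1 ∧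
      ¬ StrongNonquasianalytic exSeq ∧ ¬ GammaOne (quot (hat exSeq))) ∧
    -- (ii)
    (omegaSeq exSeq = ⊤ ∧
      upperOrder (quotStep exSeq) = ⊤ ∧ upperMatuszewska (quotStep exSeq) = ⊤ ∧
      omegaSeq (hat exSeq) = ⊤ ∧
      upperOrder (quotStep (hat exSeq)) = ⊤ ∧ upperMatuszewska (quotStep (hat exSeq)) = ⊤ ∧
      ¬ ModerateGrowth exSeq ∧ ¬ ModerateGrowth (hat exSeq)) ∧
    -- (iii)
    (lowerMatuszewska (assoc exSeq) = 0 ∧ lowerOrder (assoc exSeq) = 0 ∧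
      upperOrder (assoc exSeq) = 0 ∧ upperMatuszewska (assoc exSeq) = 0 ∧
      gammaFun (assoc exSeq) = ⊤ ∧ OmegaSnq (assoc exSeq)) ∧
    -- (iv)
    (lowerMatuszewska (assoc (hat exSeq)) = 0 ∧ lowerOrder (assoc (hat exSeq)) = 0 ∧
      upperOrder (assoc (hat exSeq)) = 0 ∧ upperMatuszewska (assoc (hat exSeq)) = 0 ∧
      gammaFun (assoc (hat exSeq)) = ⊤ ∧ OmegaSnq (assoc (hat exSeq))) ∧
    -- the general inequality between the two indices is strict here
    (gammaSeq exSeq < gammaFun (assoc exSeq) ∧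
      gammaSeq (hat exSeq) < gammaFun (assoc (hat exSeq))) := by
  have hq : ∀ p, exQuot p ≤ quot exSeq p := fun p => (quot_exSeq p).ge
  have hM := isWeightSequence_exSeq
  have hM' := isWeightSequence_hat_exSeq
  have hi := hM.indices_assoc (tendsto_log_quot_div hq)
  have hi' := hM'.indices_assoc (tendsto_log_quot_div exQuot_le_quot_hat)
  refine ⟨⟨hM, quot_exSeq, hM'⟩,
    ⟨gammaSeq_exSeq, gammaSeq_hat_exSeq, not_strongNonquasianalytic_exSeq,
      not_gammaOne_quot_hat_exSeq⟩,
    ⟨omegaSeq_eq_top hq, upperOrder_quotStep_eq_top hq,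
      upperMatuszewska_quotStep_eq_top hM.quot_pos fun p q _ => by simp only [quot_exSeq, le_refl],
      omegaSeq_eq_top exQuot_le_quot_hat, upperOrder_quotStep_eq_top exQuot_le_quot_hat,
      upperMatuszewska_quotStep_eq_top hM'.quot_pos exQuot_div_le_quot_hat_div,
      not_moderateGrowth_of_exQuot_le hM.pos hq,
      not_moderateGrowth_of_exQuot_le hM'.pos exQuot_le_quot_hat⟩, hi, hi', ?_, ?_⟩
  · rw [gammaSeq_exSeq, hi.2.2.2.2.1]
    exact EReal.coe_lt_top 0
  · rw [gammaSeq_hat_exSeq, hi'.2.2.2.2.1]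
    exact EReal.coe_lt_top 1
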